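/- Let $n$ be a positive integer and let $\Theta$ be a simple oriented graph with vertex set $[n]=\{1,\dots,n\}$, i.e. a directed graph without multiple arrows and without oriented cycles of length one or two; write $i\to j$ if there is an arrow from $i$ to $j$, and call distinct $i,j$ \emph{disconnected} if neither $i\to j$ nor $j\to i$. Let $\mathrm{HK}_\Theta$ be the Hecke--Kiselman monoid, i.e. the monoid generated by $x_1,\dots,x_n$ subject to the relations $x_i^2=x_i$ for all $i$; $x_ix_j=x_jx_i$ if $i$ and $j$ are disconnected; and $x_ix_jx_i=x_jx_ix_j=x_ix_j$ if $i\to j$. For $x\in\mathrm{HK}_\Theta$ let the content $c(x)\subseteq[n]$ be the set of indices $i$ such that $x_i$ occurs in a word representing $x$ (this does not depend on the word, since the relations preserve it). Let $A_\Theta$ be the set of all $X\subseteq[n]$ such that the full subgraph of $\Theta$ on $X$ contains no oriented cycle. For $X,Y\in A_\Theta$ say that $p(X,Y)$ holds if there do not exist $b\in Y\setminus X$, $a\in X\setminus Y$, $r\ge 0$ and $i_1,\dots,i_r\in X\cap Y$ with $b\to i_1\to\dots\to i_r\to a$ (meaning $b\to a$ if $r=0$). A sequence $(X_1,\dots,X_n)$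 of subsets of $[n]$ is called $(\Theta,p)$-pure if, for all $i,j\in[n]$: $X_i\in A_\Theta$; both $p(X_i,X_j)$ and $p(X_j,X_i)$ hold if $i$ and $j$ are disconnected; and $p(X_i,X_j)$ holds if $i\to j$. Let $S_n(\Theta,p)$ be the set of all $(\Theta,p)$-pure sequences. Theorem. For every monoid endomorphism $\varphi$ of $\mathrm{HK}_\Theta$ the sequence $$\Phi(\varphi)=\big(c(\varphi(x_1)),\dots,c(\varphi(x_n))\big)$$ is $(\Theta,p)$-pure, and the resulting map $\Phi:\mathrm{End}(\mathrm{HK}_\Theta)\to S_n(\Theta,p)$ is a bijection. -/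

import Mathlib

namespace HeckeKiselman

/-- A simple oriented graph: no oriented cycles of length one or two.
(A `Digraph` has no multiple arrows by construction.) -/
def IsSimpleOriented {n : ℕ} (Θ : Digraph (Fin n)) : Prop :=
  (∀ i, ¬ Θ.Adj i i) ∧ ∀ i j, ¬ (Θ.Adj i j ∧ Θ.Adj j i)

/-- `i` and `j` are not connected: they are distinct and there is no arrow between them. -/
def Disconnected {n : ℕ} (Θ : Digraph (Fin n)) (i j : Fin n) : Prop :=
  i ≠ j ∧ ¬ Θ.Adj i j ∧ ¬ Θ.Adj j i

/-- The defining relations of the Hecke--Kiselman monoid. -/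
inductive Rel {n : ℕ} (Θ : Digraph (Fin n)) : FreeMonoid (Fin n) → FreeMonoid (Fin n) → Prop
  | idem (i : Fin n) :
      Rel Θ (FreeMonoid.of i * FreeMonoid.of i) (FreeMonoid.of i)
  | comm (i j : Fin n) (h : Disconnected Θ i j) :
      Rel Θ (FreeMonoid.of i * FreeMonoid.of j) (FreeMonoid.of j * FreeMonoid.of i)
  | braid_left (i j : Fin n) (h : Θ.Adj i j) :
      Rel Θ (FreeMonoid.of i * FreeMonoid.of j * FreeMonoid.of i)
        (FreeMonoid.of i * FreeMonoid.of j)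
  | braid_right (i j : Fin n) (h : Θ.Adj i j) :
      Rel Θ (FreeMonoid.of j * FreeMonoid.of i * FreeMonoid.of j)
        (FreeMonoid.of i * FreeMonoid.of j)

/-- The Hecke--Kiselman monoid of `Θ`. -/
abbrev HK {n : ℕ} (Θ : Digraph (Fin n)) : Type := PresentedMonoid (Rel Θ)

/-- The generator `x_i`. -/
def gen {n : ℕ} (Θ : Digraph (Fin n)) (i : Fin n) : HK Θ := PresentedMonoid.of (Rel Θ) i

theorem symbols_eq_of_conGen {n : ℕ} (Θ : Digraph (Fin n)) {u v : FreeMonoid (Fin n)}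
    (h : conGen (Rel Θ) u v) : u.symbols = v.symbols := by
  replace h : ConGen.Rel (Rel Θ) u v := h
  induction h with
  | of u v hr =>
    cases hr with
    | idem i => simp [FreeMonoid.symbols_mul]
    | comm i j h => simp only [FreeMonoid.symbols_mul, Finset.union_comm]
    | braid_left i j h =>
      ext k; simp only [FreeMonoid.symbols_mul, Finset.mem_union]; tauto
    | braid_right i j h =>
      ext k; simp only [FreeMonoid.symbols_mul, Finset.mem_union]; tauto
  | refl u => rfl
  | symm _ ih => exact ih.symm
  | trans _ _ ih₁ ih₂ => exact ih₁.trans ih₂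
  | mul _ _ ih₁ ih₂ => rw [FreeMonoid.symbols_mul, FreeMonoid.symbols_mul, ih₁, ih₂]

/-- The content of an element of `HK Θ`: the set of indices of the letters that occur in any
word representing it. -/
def content {n : ℕ} {Θ : Digraph (Fin n)} (x : HK Θ) : Finset (Fin n) :=
  Quotient.lift (s := (conGen (Rel Θ)).toSetoid) FreeMonoid.symbols
    (fun _ _ h => symbols_eq_of_conGen Θ h) x

theorem content_mk {n : ℕ} (Θ : Digraph (Fin n)) (w : FreeMonoid (Fin n)) :
    content (PresentedMonoid.mk (Rel Θ) w) = w.symbols := rfl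

/-- `v :: l` lists, in order, the pairwise distinct vertices of an oriented cycle
`v → l₁ → ... → lₖ → v` of `Θ` (of length `k + 1`). -/
def IsOrientedCycle {n : ℕ} (Θ : Digraph (Fin n)) (v : Fin n) (l : List (Fin n)) : Prop :=
  (v :: l).Nodup ∧ List.IsChain Θ.Adj (v :: (l ++ [v]))

/-- `X ∈ A_Θ`: the full subgraph of `Θ` with vertex set `X` contains no oriented cycles. -/
def IsAcyclicOn {n : ℕ} (Θ : Digraph (Fin n)) (X : Finset (Fin n)) : Prop :=
  ¬ ∃ (v : Fin n) (l : List (Fin n)), IsOrientedCycle Θ v l ∧ ∀ i ∈ v :: l, i ∈ X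

/-- The predicate `p(X, Y)`: there are no `b ∈ Y \ X`, `a ∈ X \ Y` and (possibly empty) list
`i₁, ..., iᵣ` of elements of `X ∩ Y` with `b → i₁ → ... → iᵣ → a`. -/
def P {n : ℕ} (Θ : Digraph (Fin n)) (X Y : Finset (Fin n)) : Prop :=
  ¬ ∃ b ∈ Y \ X, ∃ a ∈ X \ Y, ∃ l : List (Fin n),
    (∀ i ∈ l, i ∈ X ∩ Y) ∧ List.IsChain Θ.Adj (b :: (l ++ [a]))

/-- `S_n(Θ, p)`, the set of `(Θ, p)`-pure sequences of subsets of the vertex set. -/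
def pureSequences {n : ℕ} (Θ : Digraph (Fin n)) : Set (Fin n → Finset (Fin n)) :=
  {X | (∀ i, IsAcyclicOn Θ (X i)) ∧
    (∀ i j, Disconnected Θ i j → P Θ (X i) (X j) ∧ P Θ (X j) (X i)) ∧
    (∀ i j, Θ.Adj i j → P Θ (X i) (X j))}

/-- The content map `Φ(φ) = (c(φ(x_1)), ..., c(φ(x_n)))`. -/
def Phi {n : ℕ} (Θ : Digraph (Fin n)) (φ : Monoid.End (HK Θ)) : Fin n → Finset (Fin n) :=
  fun i => content (φ (gen Θ i))

end HeckeKiselman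

/-! Idempotents of `HK Θ` correspond to acyclic sets via their content, and an endomorphism sends
generators to idempotents. Sufficiency rests on absorption: an idempotent with acyclic content
absorbs each letter of that content on either side, by induction along the arrows. Hence the content
determines it (`idempotent_unique`), and `p(X, Y)` makes the product of the idempotents of `X` and
`Y` idempotent. The defining relations then become equalities between idempotents of equal content.
Necessity rests on an invariant: the relations preserve the set of walks of `Θ` occurring as
subwords (`walk_sublist_iff`). A word representing an idempotent contains every walk in its content,
which excludes oriented cycles and, for a product of two elements, the walks forbidden by `p`. -/

open Relation
open scoped List

namespace HeckeKiselman

/-- A family of elements of a monoid that satisfies the Hecke--Kiselman relations of `r`. -/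
structure IsHKFamily {ι M : Type*} [Monoid M] (r : ι → ι → Prop) (g : ι → M) : Prop where
  idem : ∀ i, g i * g i = g i
  comm : ∀ i j, i ≠ j → ¬ r i j → ¬ r j i → g i * g j = g j * g i
  braid_left : ∀ i j, r i j → g i * g j * g i = g i * g j
  braid_right : ∀ i j, r i j → g j * g i * g j = g i * g j

/-- The restriction of a relation to a set. -/
def restrictRel {ι : Type*} (r : ι → ι → Prop) (Y : Set ι) (i j : ι) : Prop :=
  i ∈ Y ∧ j ∈ Y ∧ r i j

/-! ### Absorption of letters by idempotents, in any monoid. -/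

section Absorption

variable {ι M : Type*} [Monoid M] {r : ι → ι → Prop} {g : ι → M}

theorem wellFounded_of_transGen_irrefl [Finite ι] {s : ι → ι → Prop}
    (h : ∀ v, ¬ TransGen s v v) : WellFounded s := by
  have : Std.Irrefl (TransGen s) := ⟨h⟩
  have := Finite.wellFounded_of_trans_of_irrefl (TransGen s)
  exact Subrelation.wf (fun hab => TransGen.single hab) this

/-- This duality yields left absorption from right absorption. -/
theorem IsHKFamily.op (h : IsHKFamily r g) :
    IsHKFamily (fun i j => r j i) (fun i => MulOpposite.op (g i)) where
  idem i := by rw [← MulOpposite.op_mul, h.idem]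
  comm i j hij h1 h2 := by
    rw [← MulOpposite.op_mul, ← MulOpposite.op_mul, h.comm j i hij.symm h1 h2]
  braid_left i j hij := by
    simp only [← MulOpposite.op_mul, ← mul_assoc, h.braid_right j i hij]
  braid_right i j hij := by
    simp only [← MulOpposite.op_mul, ← mul_assoc, h.braid_left j i hij]

/-- If `e` absorbs `g k`, and `e * v` absorbs the predecessors of `k` for each word `v` over `Y`,
then `e * v` absorbs `g k` for each word `v` over `Y`. -/
theorem IsHKFamily.absorb_of_predecessors (h : IsHKFamily r g) {Y : Set ι} {e : M} {k : ι}
    (he : e * g k = e)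
    (hp : ∀ j ∈ Y, r j k → ∀ v : List ι, (∀ x ∈ v, x ∈ Y) →
      e * (v.map g).prod * g j = e * (v.map g).prod) :
    ∀ v : List ι, (∀ x ∈ v, x ∈ Y) → e * (v.map g).prod * g k = e * (v.map g).prod := by
  intro v
  induction v using List.reverseRecOn with
  | nil => intro _; simpa using he
  | append_singleton v j ih =>
    intro hv
    have hvY : ∀ x ∈ v, x ∈ Y := fun x hx => hv x (by simp [hx])
    have hj : j ∈ Y := hv j (by simp)
    have ihv := ih hvY
    simp only [List.map_append, List.prod_append, List.map_cons, List.map_nil, List.prod_cons,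
      List.prod_nil, mul_one, ← mul_assoc]
    set u := e * (v.map g).prod with hu
    by_cases hjk : j = k
    · subst hjk; rw [mul_assoc, h.idem]
    by_cases h1 : r j k
    · rw [hp j hj h1 v hvY, ihv]
    by_cases h2 : r k j
    -- Absorption in reverse inserts a `g k` before `g j`, and the braid relation then removes the
    -- last one.
    · calc u * g j * g k = u * g k * g j * g k := by rw [ihv]
        _ = u * (g k * g j * g k) := by simp only [mul_assoc]
        _ = u * g k * g j := by rw [h.braid_left k j h2, ← mul_assoc]
        _ = u * g j := by rw [ihv]
    · rw [mul_assoc, h.comm j k hjk h1 h2, ← mul_assoc, ihv]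

theorem mul_map_prod_eq_self {e : M} {v : List ι} (h : ∀ k ∈ v, e * g k = e) :
    e * (v.map g).prod = e := by
  induction v with
  | nil => simp
  | cons a v ih =>
    rw [List.map_cons, List.prod_cons, ← mul_assoc, h a (by simp),
      ih fun k hk => h k (by simp [hk])]

/-- An idempotent word with acyclic content absorbs its letters on the right. -/
theorem IsHKFamily.idempotent_absorb [Finite ι] (h : IsHKFamily r g) {w : List ι}
    (hw : (w.map g).prod * (w.map g).prod = (w.map g).prod)
    (hac : ∀ v, ¬ TransGen (restrictRel r {x | x ∈ w}) v v) {k : ι} (hk : k ∈ w) :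
    (w.map g).prod * g k = (w.map g).prod := by
  -- The induction needs absorption to survive any further word `v` over the letters of `w`.
  suffices H : ∀ k, k ∈ w → ∀ v : List ι, (∀ x ∈ v, x ∈ {x | x ∈ w}) →
      (w.map g).prod * (v.map g).prod * g k = (w.map g).prod * (v.map g).prod by
    simpa using H k hk [] (by simp)
  intro k
  induction k using (wellFounded_of_transGen_irrefl hac).induction with
  | _ k ih =>
    intro hk v hv
    obtain ⟨s, t, hst⟩ := List.append_of_mem hk
    -- With `w = s k t`, the element `w s k` absorbs `k`; appending `t v` gives `w w v = w v`.
    have key := h.absorb_of_predecessors (Y := {x | x ∈ w})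
      (e := (w.map g).prod * (s.map g).prod * g k) (k := k)
      (by rw [mul_assoc, h.idem]) (fun j hj hjk u hu => by
        have := ih j ⟨hj, hk, hjk⟩ hj (s ++ k :: u) (by
          intro x hx
          rcases List.mem_append.1 hx with hx | hx
          · simp [hst, hx]
          · rcases List.mem_cons.1 hx with rfl | hx
            · exact hk
            · exact hu x hx)
        simpa [mul_assoc] using this)
      (t ++ v) (by
        intro x hx
        rcases List.mem_append.1 hx with hx | hx
        · simp [hst, hx]
        · exact hv x hx)
    have e1 : (w.map g).prod * (s.map g).prod * g k * ((t ++ v).map g).prod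
        = (w.map g).prod * (v.map g).prod := by
      calc _ = (w.map g).prod * ((s ++ k :: t).map g).prod * (v.map g).prod := by
            simp [mul_assoc]
        _ = _ := by rw [← hst, hw]
    rwa [e1] at key

theorem op_map_prod (w : List ι) :
    (w.reverse.map fun i => MulOpposite.op (g i)).prod = MulOpposite.op (w.map g).prod := by
  induction w with
  | nil => simp
  | cons a w ih =>
    rw [List.reverse_cons, List.map_append, List.prod_append, ih]; simp

/-- An idempotent word with acyclic content absorbs its letters on the left. -/
theorem IsHKFamily.idempotent_absorb_left [Finite ι] (h : IsHKFamily r g) {w : List ι}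
    (hw : (w.map g).prod * (w.map g).prod = (w.map g).prod)
    (hac : ∀ v, ¬ TransGen (restrictRel r {x | x ∈ w}) v v) {k : ι} (hk : k ∈ w) :
    g k * (w.map g).prod = (w.map g).prod := by
  have := h.op.idempotent_absorb (w := w.reverse) (k := k)
    (by rw [op_map_prod, ← MulOpposite.op_mul, hw])
    (by
      intro v hv
      apply hac v
      rw [← transGen_swap]
      refine TransGen.mono (fun a b hab => ?_) v v hv
      exact ⟨by simpa using hab.2.1, by simpa using hab.1, hab.2.2⟩) (by simpa using hk)
  rw [op_map_prod, ← MulOpposite.op_mul] at this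
  exact MulOpposite.op_injective this

/-- An idempotent word is determined by its content, if this is acyclic. -/
theorem IsHKFamily.idempotent_unique [Finite ι] (h : IsHKFamily r g) {w w' : List ι}
    (hw : (w.map g).prod * (w.map g).prod = (w.map g).prod)
    (hw' : (w'.map g).prod * (w'.map g).prod = (w'.map g).prod)
    (hac : ∀ v, ¬ TransGen (restrictRel r {x | x ∈ w}) v v)
    (hww : ∀ x, x ∈ w ↔ x ∈ w') : (w.map g).prod = (w'.map g).prod := by
  -- The product of the two equals the first by right absorption and the second by left absorption.
  have h1 : (w.map g).prod * (w'.map g).prod = (w.map g).prod :=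
    mul_map_prod_eq_self fun k hk => h.idempotent_absorb hw hac ((hww k).2 hk)
  have hset : {x | x ∈ w} = {x | x ∈ w'} := Set.ext hww
  rw [hset] at hac
  have h2 : ∀ v : List ι, (∀ x ∈ v, x ∈ w') →
      (v.map g).prod * (w'.map g).prod = (w'.map g).prod := by
    intro v
    induction v with
    | nil => simp
    | cons a v ih =>
      intro hv
      rw [List.map_cons, List.prod_cons, mul_assoc, ih fun x hx => hv x (by simp [hx]),
        h.idempotent_absorb_left hw' hac (hv a (by simp))]
  rw [← h1, h2 w fun x hx => (hww x).1 hx]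

/-- If every path whose vertices before the last lie in `w'`, and that ends in a letter of `w`
outside `w'`, starts in `w`, then the product of the idempotents of `w` and `w'` is idempotent. -/
theorem IsHKFamily.mul_idempotent [Finite ι] (h : IsHKFamily r g) {w w' : List ι}
    (hw : (w.map g).prod * (w.map g).prod = (w.map g).prod)
    (hw' : (w'.map g).prod * (w'.map g).prod = (w'.map g).prod)
    (hac : ∀ v, ¬ TransGen (restrictRel r {x | x ∈ w}) v v)
    (hac' : ∀ v, ¬ TransGen (restrictRel r {x | x ∈ w'}) v v)
    (hP : ∀ a ∈ w, a ∉ w' → ∀ j, TransGen (fun i j => i ∈ w' ∧ r i j) j a → j ∈ w) :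
    (w.map g).prod * (w'.map g).prod * ((w.map g).prod * (w'.map g).prod)
      = (w.map g).prod * (w'.map g).prod := by
  -- The condition on `k` passes to its predecessors in `w'`, so the induction along arrows inside
  -- `w` applies.
  have good : ∀ k, k ∈ w → (∀ j, TransGen (fun i j => i ∈ w' ∧ r i j) j k → j ∈ w) →
      ∀ v : List ι, (∀ x ∈ v, x ∈ {x | x ∈ w'}) →
        (w.map g).prod * (v.map g).prod * g k = (w.map g).prod * (v.map g).prod := by
    intro k
    induction k using (wellFounded_of_transGen_irrefl hac).induction with
    | _ k ih =>
      intro hk hgood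
      refine h.absorb_of_predecessors (h.idempotent_absorb hw hac hk) fun j hj hjk => ?_
      have hjw : j ∈ w := hgood j (.single ⟨hj, hjk⟩)
      exact ih j ⟨hjw, hk, hjk⟩ hjw fun i hi => hgood i (hi.tail ⟨hj, hjk⟩)
  have hright : ∀ k ∈ w', (w.map g).prod * (w'.map g).prod * g k
      = (w.map g).prod * (w'.map g).prod := fun k hk => by
    rw [mul_assoc, h.idempotent_absorb hw' hac' hk]
  have hleft : ∀ k ∈ w, (w.map g).prod * (w'.map g).prod * g k
      = (w.map g).prod * (w'.map g).prod := fun k hk => by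
    by_cases hk' : k ∈ w'
    · exact hright k hk'
    · exact good k hk (hP k hk hk') w' fun x hx => hx
  rw [← mul_assoc, mul_map_prod_eq_self hleft, mul_map_prod_eq_self hright]

/-- Every acyclic finite set is the content of an idempotent word. -/
theorem IsHKFamily.exists_idempotent [Finite ι] (h : IsHKFamily r g) (X : Finset ι)
    (hac : ∀ v, ¬ TransGen (restrictRel r X) v v) :
    ∃ w : List ι, (∀ x, x ∈ w ↔ x ∈ X) ∧
      (w.map g).prod * (w.map g).prod = (w.map g).prod := by
  classical
  induction X using Finset.strongInduction with
  | _ X ih =>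
    rcases X.eq_empty_or_nonempty with rfl | hne
    · exact ⟨[], by simp, by simp⟩
    obtain ⟨m, hm, hmin⟩ := (wellFounded_of_transGen_irrefl hac).has_min (X : Set ι) hne
    obtain ⟨w, hwX, hw⟩ := ih (X.erase m) (Finset.erase_ssubset hm) (fun v hv => hac v
      (TransGen.mono (fun a b hab =>
        ⟨Finset.mem_of_mem_erase hab.1, Finset.mem_of_mem_erase hab.2.1, hab.2.2⟩) v v hv))
    refine ⟨m :: w, fun x => ?_, ?_⟩
    · rw [List.mem_cons, hwX, Finset.mem_erase]
      refine ⟨?_, fun hx => ?_⟩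
      · rintro (rfl | hx)
        · exact hm
        · exact hx.2
      · by_cases hxm : x = m
        · exact Or.inl hxm
        · exact Or.inr ⟨hxm, hx⟩
    -- A source `m` of `X` has no predecessors to check, so `m w` absorbs `m` and `m w m w = m w w =
    -- m w`.
    · have key := h.absorb_of_predecessors (Y := (X : Set ι)) (e := g m) (k := m) (h.idem m)
        (fun j hj hjm => absurd ⟨hj, hm, hjm⟩ (hmin j hj)) w
        (fun x hx => Finset.mem_of_mem_erase ((hwX x).1 hx))
      rw [List.map_cons, List.prod_cons, ← mul_assoc, key, mul_assoc, hw]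

end Absorption

/-! ### Walks, cycles and the subword invariant. -/

section Walks

/-- A repeated vertex cuts out a shorter closed walk. -/
theorem exists_nodup_cycle {n : ℕ} {Θ : Digraph (Fin n)} (l : List (Fin n)) :
    ∀ v, List.IsChain Θ.Adj (v :: (l ++ [v])) →
      ∃ v' l', IsOrientedCycle Θ v' l' ∧ ∀ i ∈ v' :: l', i ∈ v :: l := by
  induction hN : l.length using Nat.strong_induction_on generalizing l with
  | _ N ih =>
    intro v hv
    subst hN
    by_cases hnd : (v :: l).Nodup
    · exact ⟨v, l, ⟨hnd, hv⟩, fun i hi => hi⟩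
    by_cases hvl : v ∈ l
    · obtain ⟨s, t, rfl⟩ := List.append_of_mem hvl
      obtain ⟨v', l', hc, hmem⟩ := ih s.length (by simp) s rfl v
        (hv.infix ⟨[], t ++ [v], by simp⟩)
      exact ⟨v', l', hc, fun i hi => by have := hmem i hi; simp at this ⊢; tauto⟩
    · have hnd' : ¬ l.Nodup := fun h => hnd (List.nodup_cons.2 ⟨hvl, h⟩)
      obtain ⟨u, hu⟩ : ∃ u, [u, u] <+ l := by
        by_contra hcon
        exact hnd' (List.nodup_iff_sublist.2 fun a ha => hcon ⟨a, ha⟩)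
      obtain ⟨s, t, rfl, h1, h2⟩ := List.cons_sublist_iff.1 hu
      obtain ⟨s1, s2, rfl⟩ := List.append_of_mem h1
      obtain ⟨t1, t2, rfl⟩ := List.append_of_mem (List.singleton_sublist.1 h2)
      obtain ⟨v', l', hc, hmem⟩ := ih (s2 ++ t1).length (by simp; omega) (s2 ++ t1) rfl u
        (hv.infix ⟨v :: s1, t2 ++ [v], by simp⟩)
      exact ⟨v', l', hc, fun i hi => by have := hmem i hi; simp at this ⊢; tauto⟩

theorem isAcyclicOn_iff {n : ℕ} {Θ : Digraph (Fin n)} {X : Finset (Fin n)} :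
    IsAcyclicOn Θ X ↔ ∀ v, ¬ TransGen (restrictRel Θ.Adj X) v v := by
  refine ⟨fun h v hv => h ?_, fun h => ?_⟩
  · have walk : ∀ u, TransGen (restrictRel Θ.Adj X) u v → u ∈ X ∧
        ∃ l : List (Fin n), (∀ i ∈ l, i ∈ X) ∧ List.IsChain Θ.Adj (u :: (l ++ [v])) := by
      intro u hu
      induction hu using TransGen.head_induction_on with
      | single hu => exact ⟨hu.1, [], by simp, by simpa using hu.2.2⟩
      | @head b c hu _ ih =>
        obtain ⟨hc, l, hl, hch⟩ := ih
        refine ⟨hu.1, c :: l, ?_, ?_⟩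
        · intro i hi
          rcases List.mem_cons.1 hi with rfl | hi
          · exact hc
          · exact hl i hi
        · exact List.isChain_cons_cons.2 ⟨hu.2.2, hch⟩
    obtain ⟨hvX, l, hl, hch⟩ := walk v hv
    obtain ⟨v', l', hc, hmem⟩ := exists_nodup_cycle l v hch
    refine ⟨v', l', hc, fun i hi => ?_⟩
    rcases List.mem_cons.1 (hmem i hi) with rfl | hi
    · exact hvX
    · exact hl i hi
  · rintro ⟨v, l, ⟨-, hch⟩, hX⟩
    have walk : ∀ (l : List (Fin n)) (u : Fin n), u ∈ X → v ∈ X → (∀ i ∈ l, i ∈ X) →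
        List.IsChain Θ.Adj (u :: (l ++ [v])) → TransGen (restrictRel Θ.Adj X) u v := by
      intro l
      induction l with
      | nil => intro u hu hv _ hch; exact .single ⟨hu, hv, by simpa using hch⟩
      | cons a l ih =>
        intro u hu hv hl hch
        obtain ⟨h1, h2⟩ := List.isChain_cons_cons.1 hch
        exact TransGen.head ⟨hu, hl a (by simp), h1⟩
          (ih a (hl a (by simp)) hv (fun i hi => hl i (by simp [hi])) h2)
    have hv := hX v (by simp)
    exact h v (walk l v hv hv (fun i hi => hX i (by simp [hi])) hch)

/-- The walks that are subwords of a word depend only on the element that the word represents. -/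
theorem walk_sublist_iff {n : ℕ} {Θ : Digraph (Fin n)} (hΘ : IsSimpleOriented Θ)
    {u v : FreeMonoid (Fin n)} (h : conGen (Rel Θ) u v) :
    ∀ c : List (Fin n), List.IsChain Θ.Adj c → (c <+ u.toList ↔ c <+ v.toList) := by
  replace h : ConGen.Rel (Rel Θ) u v := h
  induction h with
  | of u v hr =>
    intro c hc
    have irr := hΘ.1
    have asymm := hΘ.2
    -- Without loops or 2-cycles, the only walks inside either side of a relation are single letters
    -- and, for `i → j`, the word `i j`; both sides contain the same ones.
    cases hr with
    | _ =>
      simp only [FreeMonoid.toList_mul, FreeMonoid.toList_of, List.cons_append, List.nil_append]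
      rcases c with _ | ⟨x, _ | ⟨y, _ | ⟨z, t⟩⟩⟩ <;>
        simp only [List.cons_sublist_cons', List.isChain_cons_cons, List.nil_sublist,
          List.sublist_nil] at hc ⊢ <;> grind [Disconnected]
  | refl u => intro c _; rfl
  | symm _ ih => intro c hc; exact (ih c hc).symm
  | trans _ _ ih₁ ih₂ => intro c hc; exact (ih₁ c hc).trans (ih₂ c hc)
  | mul _ _ ih₁ ih₂ =>
    intro c hc
    simp only [FreeMonoid.toList_mul, List.sublist_append_iff]
    constructor
    · rintro ⟨c₁, c₂, rfl, h₁, h₂⟩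
      exact ⟨c₁, c₂, rfl, (ih₁ c₁ hc.left_of_append).1 h₁, (ih₂ c₂ hc.right_of_append).1 h₂⟩
    · rintro ⟨c₁, c₂, rfl, h₁, h₂⟩
      exact ⟨c₁, c₂, rfl, (ih₁ c₁ hc.left_of_append).2 h₁, (ih₂ c₂ hc.right_of_append).2 h₂⟩

end Walks

/-! ### Idempotents of the Hecke–Kiselman monoid and their contents. -/

section Presentation

variable {n : ℕ} (Θ : Digraph (Fin n))

theorem gen_isHKFamily : IsHKFamily Θ.Adj (gen Θ) where
  idem i := PresentedMonoid.mk_eq_mk_of_rel (Rel.idem i)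
  comm i j hij h1 h2 := PresentedMonoid.mk_eq_mk_of_rel (Rel.comm i j ⟨hij, h1, h2⟩)
  braid_left i j h := PresentedMonoid.mk_eq_mk_of_rel (Rel.braid_left i j h)
  braid_right i j h := PresentedMonoid.mk_eq_mk_of_rel (Rel.braid_right i j h)

theorem mk_eq_prod (w : List (Fin n)) :
    PresentedMonoid.mk (Rel Θ) (FreeMonoid.ofList w) = (w.map (gen Θ)).prod := by
  induction w with
  | nil => exact map_one _
  | cons a w ih =>
    rw [List.map_cons, List.prod_cons, ← ih, FreeMonoid.ofList_cons, map_mul]; rfl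

theorem exists_word (x : HK Θ) : ∃ w : List (Fin n), x = (w.map (gen Θ)).prod := by
  obtain ⟨w, rfl⟩ := PresentedMonoid.surjective_mk x
  exact ⟨w.toList, by rw [← mk_eq_prod]; rfl⟩

theorem content_prod (w : List (Fin n)) : content (w.map (gen Θ)).prod = w.toFinset := by
  rw [← mk_eq_prod, content_mk]; rfl

theorem mem_content_prod {w : List (Fin n)} {i : Fin n} :
    i ∈ content (w.map (gen Θ)).prod ↔ i ∈ w := by
  rw [content_prod, List.mem_toFinset]

variable {Θ}

theorem walk_sublist_of_prod_eq (hΘ : IsSimpleOriented Θ) {w w' : List (Fin n)}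
    (h : (w.map (gen Θ)).prod = (w'.map (gen Θ)).prod) {c : List (Fin n)}
    (hc : List.IsChain Θ.Adj c) (hcw : c <+ w) : c <+ w' := by
  rw [← mk_eq_prod, ← mk_eq_prod, PresentedMonoid.mk_eq_mk_iff] at h
  exact (walk_sublist_iff hΘ h c hc).1 hcw

/-- Every walk in the content of an idempotent word is a subword of it. -/
theorem walk_sublist_of_idempotent (hΘ : IsSimpleOriented Θ) {w : List (Fin n)}
    (hw : (w.map (gen Θ)).prod * (w.map (gen Θ)).prod = (w.map (gen Θ)).prod)
    {c : List (Fin n)} (hc : List.IsChain Θ.Adj c) (hcw : ∀ i ∈ c, i ∈ w) : c <+ w := by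
  induction c with
  | nil => simp
  | cons a c ih =>
    have h1 := ih hc.tail fun i hi => hcw i (by simp [hi])
    -- In `w w`, the letter `a` comes from the first copy and the rest of the walk from the second.
    refine walk_sublist_of_prod_eq hΘ (w := w ++ w) (by rw [List.map_append, List.prod_append, hw])
      hc ?_
    exact (List.singleton_sublist.2 (hcw a (by simp))).append h1

/-- Going round a cycle gives arbitrarily long walks, all of which would be subwords of one finite
word. -/
theorem isAcyclicOn_content (hΘ : IsSimpleOriented Θ) {x : HK Θ} (hx : x * x = x) :
    IsAcyclicOn Θ (content x) := by
  obtain ⟨w, rfl⟩ := exists_word Θ x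
  rw [isAcyclicOn_iff]
  intro v hv
  have long : ∀ m : ℕ, ∃ u, TransGen (restrictRel Θ.Adj (content (w.map (gen Θ)).prod)) u u ∧
      ∃ c : List (Fin n), List.IsChain Θ.Adj (u :: c) ∧ (∀ i ∈ u :: c, i ∈ w) ∧ c.length = m := by
    intro m
    induction m with
    | zero =>
      refine ⟨v, hv, [], by simp, ?_, rfl⟩
      obtain ⟨u, hu, -⟩ := TransGen.head'_iff.1 hv
      simpa using (mem_content_prod Θ).1 hu.1
    | succ m ih =>
      obtain ⟨u, hu, c, hc, hcw, rfl⟩ := ih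
      obtain ⟨t, hut, htu⟩ := TransGen.tail'_iff.1 hu
      refine ⟨t, TransGen.head' htu hut, u :: c, List.isChain_cons_cons.2 ⟨htu.2.2, hc⟩, ?_, rfl⟩
      intro i hi
      rcases List.mem_cons.1 hi with rfl | hi
      · exact (mem_content_prod Θ).1 htu.1
      · exact hcw i hi
  obtain ⟨u, -, c, hc, hcw, hlen⟩ := long w.length
  have := (walk_sublist_of_idempotent hΘ hx hc hcw).length_le
  simp [hlen] at this

theorem content_mul (x y : HK Θ) : content (x * y) = content x ∪ content y := by
  obtain ⟨w, rfl⟩ := exists_word Θ x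
  obtain ⟨w', rfl⟩ := exists_word Θ y
  rw [← List.prod_append, ← List.map_append, content_prod, content_prod, content_prod,
    List.toFinset_append]

theorem eq_of_content_eq (hΘ : IsSimpleOriented Θ) {x y : HK Θ} (hx : x * x = x) (hy : y * y = y)
    (hxy : content x = content y) : x = y := by
  have hac := isAcyclicOn_iff.1 (isAcyclicOn_content hΘ hx)
  obtain ⟨w, rfl⟩ := exists_word Θ x
  obtain ⟨w', rfl⟩ := exists_word Θ y
  refine (gen_isHKFamily Θ).idempotent_unique hx hy ?_ fun i => ?_
  · convert hac using 4
    simp [content_prod]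
  · rw [← mem_content_prod Θ, hxy, mem_content_prod]

theorem P_of_mul_idempotent (hΘ : IsSimpleOriented Θ) {x y : HK Θ}
    (hxy : x * y * (x * y) = x * y) : P Θ (content x) (content y) := by
  obtain ⟨w, rfl⟩ := exists_word Θ x
  obtain ⟨w', rfl⟩ := exists_word Θ y
  rintro ⟨b, hb, a, ha, l, hl, hch⟩
  simp only [Finset.mem_sdiff, Finset.mem_inter, mem_content_prod] at hb ha hl
  have hsub := walk_sublist_of_idempotent hΘ (w := w ++ w')
    (by simpa only [List.map_append, List.prod_append] using hxy) hch (by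
      intro i hi
      simp only [List.mem_cons, List.mem_append, List.not_mem_nil, or_false] at hi ⊢
      rcases hi with rfl | hi | rfl
      · exact Or.inr hb.1
      · exact Or.inl (hl i hi).1
      · exact Or.inl ha.1)
  -- Since `b` is not in `w`, the whole walk lies in the factor `w'`, which lacks `a`.
  obtain ⟨c₁, c₂, hc, h₁, h₂⟩ := List.sublist_append_iff.1 hsub
  rcases c₁ with _ | ⟨b', c₁⟩
  · rw [List.nil_append] at hc
    exact ha.2 (h₂.subset (by rw [← hc]; simp))
  · obtain ⟨rfl, -⟩ := List.cons.inj hc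
    exact hb.2 (h₁.subset (by simp))

theorem mul_idempotent_of_P (hΘ : IsSimpleOriented Θ) {x y : HK Θ} (hx : x * x = x)
    (hy : y * y = y) (hP : P Θ (content x) (content y)) : x * y * (x * y) = x * y := by
  have hac := isAcyclicOn_iff.1 (isAcyclicOn_content hΘ hx)
  have hac' := isAcyclicOn_iff.1 (isAcyclicOn_content hΘ hy)
  obtain ⟨w, rfl⟩ := exists_word Θ x
  obtain ⟨w', rfl⟩ := exists_word Θ y
  refine (gen_isHKFamily Θ).mul_idempotent hx hy ?_ ?_ fun a ha ha' j hj => ?_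
  · convert hac using 4
    simp [content_prod]
  · convert hac' using 4
    simp [content_prod]
  · have walk : j ∈ w ∧ j ∈ w' ∧ ∃ l : List (Fin n), (∀ i ∈ l, i ∈ w ∧ i ∈ w') ∧
        List.IsChain Θ.Adj (j :: (l ++ [a])) := by
      -- Reading the path backwards from `a`, the first vertex outside `w` would be a forbidden `b`.
      have step : ∀ (j : Fin n) (l : List (Fin n)), j ∈ w' → (∀ i ∈ l, i ∈ w ∧ i ∈ w') →
          List.IsChain Θ.Adj (j :: (l ++ [a])) → j ∈ w := by
        intro j l hj hl hch
        by_contra hjw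
        exact hP ⟨j, by simp [content_prod, hj, hjw], a, by simp [content_prod, ha, ha'], l,
          by simpa [content_prod] using hl, hch⟩
      induction hj using TransGen.head_induction_on with
      | @single b hj =>
        have hch : List.IsChain Θ.Adj (b :: ([] ++ [a])) := by simpa using hj.2
        exact ⟨step _ [] hj.1 (by simp) hch, hj.1, [], by simp, hch⟩
      | @head b c hj _ ih =>
        obtain ⟨h1, h2, l, hl, hch⟩ := ih
        have hl' := List.forall_mem_cons.2 ⟨⟨h1, h2⟩, hl⟩
        have hch' := List.isChain_cons_cons.2 ⟨hj.2, hch⟩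
        exact ⟨step b _ hj.1 hl' hch', hj.1, c :: l, hl', hch'⟩
    exact walk.1

theorem exists_idempotent_content {X : Finset (Fin n)} (hX : IsAcyclicOn Θ X) :
    ∃ x : HK Θ, x * x = x ∧ content x = X := by
  obtain ⟨w, hwX, hw⟩ := (gen_isHKFamily Θ).exists_idempotent X (isAcyclicOn_iff.1 hX)
  exact ⟨_, hw, by ext i; rw [mem_content_prod, hwX]⟩

end Presentation

end HeckeKiselman

/-! ### Endomorphisms and pure sequences. -/

open HeckeKiselman in
theorem HeckeKiselman.mapsTo_Phi {n : ℕ} {Θ : Digraph (Fin n)} (hΘ : IsSimpleOriented Θ)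
    (φ : Monoid.End (HK Θ)) : Phi Θ φ ∈ pureSequences Θ := by
  have hg := gen_isHKFamily Θ
  have hid : ∀ i, φ (gen Θ i) * φ (gen Θ i) = φ (gen Θ i) := fun i => by
    rw [← map_mul, hg.idem]
  have hcomm : ∀ i j, Disconnected Θ i j → P Θ (Phi Θ φ i) (Phi Θ φ j) := by
    intro i j h
    refine P_of_mul_idempotent hΘ ?_
    simp only [← map_mul]
    congr 1
    calc gen Θ i * gen Θ j * (gen Θ i * gen Θ j)
        = gen Θ i * (gen Θ j * gen Θ i) * gen Θ j := by simp only [mul_assoc]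
      _ = gen Θ i * gen Θ i * (gen Θ j * gen Θ j) := by
          rw [← hg.comm i j h.1 h.2.1 h.2.2]; simp only [mul_assoc]
      _ = _ := by rw [hg.idem, hg.idem]
  refine ⟨fun i => isAcyclicOn_content hΘ (hid i), fun i j h => ⟨hcomm i j h, ?_⟩, fun i j h => ?_⟩
  · exact hcomm j i ⟨h.1.symm, h.2.2, h.2.1⟩
  · refine P_of_mul_idempotent hΘ ?_
    simp only [← map_mul]
    congr 1
    rw [← mul_assoc, hg.braid_left i j h, mul_assoc, hg.idem]

open HeckeKiselman in
theorem HeckeKiselman.injective_Phi {n : ℕ} {Θ : Digraph (Fin n)} (hΘ : IsSimpleOriented Θ) :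
    Function.Injective (Phi Θ) := by
  have hg := gen_isHKFamily Θ
  intro φ ψ h
  refine PresentedMonoid.ext (Rel Θ) fun i => ?_
  refine eq_of_content_eq hΘ ?_ ?_ (congrFun h i)
  · exact (map_mul φ _ _).symm.trans (congrArg φ (hg.idem i))
  · exact (map_mul ψ _ _).symm.trans (congrArg ψ (hg.idem i))

-- Each generator goes to the idempotent of content `X i`. In every defining relation both sides
-- become idempotents of equal content, hence agree.
open HeckeKiselman in
theorem HeckeKiselman.exists_Phi_eq {n : ℕ} {Θ : Digraph (Fin n)} (hΘ : IsSimpleOriented Θ)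
    {X : Fin n → Finset (Fin n)} (hX : X ∈ pureSequences Θ) : ∃ φ, Phi Θ φ = X := by
  obtain ⟨hac, hdis, hadj⟩ := hX
  choose e he hc using fun i => exists_idempotent_content (hac i)
  have hmul : ∀ i j, P Θ (X i) (X j) → e i * e j * (e i * e j) = e i * e j := fun i j h =>
    mul_idempotent_of_P hΘ (he i) (he j) (by rwa [hc, hc])
  refine ⟨PresentedMonoid.lift e ?_, ?_⟩
  · intro u v huv
    cases huv with
    | idem i => simpa using he i
    | comm i j h =>
      simp only [map_mul, FreeMonoid.lift_eval_of]
      exact eq_of_content_eq hΘ (hmul i j (hdis i j h).1) (hmul j i (hdis i j h).2)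
        (by rw [content_mul, content_mul, Finset.union_comm])
    | braid_left i j h =>
      simp only [map_mul, FreeMonoid.lift_eval_of]
      have hij := hmul i j (hadj i j h)
      refine eq_of_content_eq hΘ ?_ hij (by simp only [content_mul]; ext; simp; tauto)
      calc e i * e j * e i * (e i * e j * e i)
          = e i * e j * (e i * e i) * e j * e i := by simp only [mul_assoc]
        _ = e i * e j * (e i * e j) * e i := by rw [he]; simp only [mul_assoc]
        _ = _ := by rw [hij]
    | braid_right i j h =>
      simp only [map_mul, FreeMonoid.lift_eval_of]
      have hij := hmul i j (hadj i j h)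
      refine eq_of_content_eq hΘ ?_ hij (by simp only [content_mul]; ext; simp; tauto)
      calc e j * e i * e j * (e j * e i * e j)
          = e j * (e i * (e j * e j) * (e i * e j)) := by simp only [mul_assoc]
        _ = e j * (e i * e j * (e i * e j)) := by rw [he]
        _ = _ := by rw [hij, mul_assoc]
  · funext i
    exact hc i

theorem mainTheorem4 {n : ℕ} (Θ : Digraph (Fin n)) (hΘ : HeckeKiselman.IsSimpleOriented Θ) :
    Set.BijOn (HeckeKiselman.Phi Θ) Set.univ (HeckeKiselman.pureSequences Θ) := by
  refine ⟨fun φ _ => HeckeKiselman.mapsTo_Phi hΘ φ, (HeckeKiselman.injective_Phi hΘ).injOn,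
    fun X hX => ?_⟩
  obtain ⟨φ, hφ⟩ := HeckeKiselman.exists_Phi_eq hΘ hX
  exact ⟨φ, Set.mem_univ φ, hφ⟩
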